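/- Let $q,x,y,z$ be indeterminates. Write $[n]_q=1+q+\cdots+q^{n-1}$ and $[n]_q!=\prod_{j=1}^n[j]_q$ (so $[0]_q!=1$). For a sequence $(a_n)_{n\ge 0}$ let $T_\infty((a_n)_{n\ge0})$ be the infinite lower-triangular Toeplitz matrix with $(n,k)$-entry $a_{n-k}$ if $k\le n$ and $0$ otherwise ($n,k\ge 0$), and let $T_\infty(y)=T_\infty((y^n)_{n\ge 0})$. Let $D_q=\mathrm{diag}(([n]_q!)_{n\ge0})$, let $\Delta=(\delta_{n+1,k})_{n,k\ge0}$, and set $$\mathsf P'(q,y,z)=D_q\,T_\infty\big((z^n/[n]_q!)_{n\ge 0}\big)\,T_\infty(y)\,D_q^{-1}\,\Delta ,$$ a row-finite matrix with entries in the field $\mathbb R(q,x,y,z)$. Let $\hat{\mathsf F}(q,y,z)=(\hat f_{n,k}(q,y,z))_{n,k\ge0}$ be its output matrix, that is, $\hat f_{n,k}(q,y,z)=(\mathsf P'(q,y,z)^n)_{0,k}$, and let $$\hat{\mathsf F}_n(x;q,y,z)=\sum_{k=0}^n \hat f_{n,k}(q,y,z)\,x^k\qquad(n\ge 0)$$ be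 its row-generating polynomials. Then every $\hat{\mathsf F}_n(x;q,y,z)$ belongs to $\mathbb R[q,x,y,z]$, and the sequence $(\hat{\mathsf F}_n(x;q,y,z))_{n\ge0}$ is coefficientwise Hankel-totally positive jointly in $q,x,y,z$: every minor of the infinite Hankel matrix $(\hat{\mathsf F}_{n+k}(x;q,y,z))_{n,k\ge 0}$ is a polynomial in $q,x,y,z$ with nonnegative coefficients. -/

import Mathlib

namespace QForest

/-! ### Infinite matrices with rows and columns indexed by the natural numbers -/

section InfiniteMatrices

variable {K : Type*} [Field K]

/-- Every row has only finitely many nonzero entries. -/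
def RowFinite (A : Matrix ℕ ℕ K) : Prop :=
  ∀ n, {k | A n k ≠ 0}.Finite

/-- Product of infinite matrices, `(A B)_{n,k} = ∑_j A_{n,j} B_{j,k}`.  The sum has finite support
as soon as `A` is row-finite, and row-finiteness holds for every left factor below. -/
noncomputable def infMul (A B : Matrix ℕ ℕ K) : Matrix ℕ ℕ K :=
  Matrix.of fun n k => ∑ᶠ j, A n j * B j k

/-- Powers of an infinite matrix. -/
noncomputable def infPow (A : Matrix ℕ ℕ K) : ℕ → Matrix ℕ ℕ K
  | 0 => 1
  | n + 1 => infMul (infPow A n) A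

/-- The output matrix `O(P)`: row `n` of `O(P)` is the zeroth row of `P ^ n`. -/
noncomputable def outputMatrix (P : Matrix ℕ ℕ K) : Matrix ℕ ℕ K :=
  Matrix.of fun n k => infPow P n 0 k

/-- The Toeplitz matrix `T_∞(a)`, with entries `a_{n-k}` for `k ≤ n`, and `0` otherwise. -/
def toeplitz (a : ℕ → K) : Matrix ℕ ℕ K :=
  Matrix.of fun n k => if k ≤ n then a (n - k) else 0

/-- The matrix `Δ = (δ_{n+1,k})`, with `1` on the superdiagonal and `0` elsewhere. -/
def shiftMatrix : Matrix ℕ ℕ K :=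
  Matrix.of fun n k => if n + 1 = k then 1 else 0

/-- `[n]_q = 1 + q + ⋯ + q^(n-1)`. -/
def qNumber (q : K) (n : ℕ) : K := ∑ i ∈ Finset.range n, q ^ i

/-- `[n]_q! = [1]_q [2]_q ⋯ [n]_q`. -/
def qFactorial (q : K) (n : ℕ) : K := ∏ j ∈ Finset.Icc 1 n, qNumber q j

/-- `P'(q,y,z) = D_q T_∞((z^n/[n]_q!)_n) T_∞(y) D_q⁻¹ Δ`, where `D_q = diag([n]_q!)` and
`T_∞(y)` is the Toeplitz matrix of powers of `y`. -/
noncomputable def productionMatrix (q y z : K) : Matrix ℕ ℕ K :=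
  infMul
    (infMul
      (infMul
        (infMul
          (Matrix.diagonal fun n => qFactorial q n)
          (toeplitz fun n => z ^ n / qFactorial q n))
        (toeplitz fun n => y ^ n))
      (Matrix.diagonal fun n => (qFactorial q n)⁻¹))
    shiftMatrix

/-- The matrix `F̂(q,y,z) = O(P'(q,y,z))`. -/
noncomputable def forestMatrix (q y z : K) : Matrix ℕ ℕ K :=
  outputMatrix (productionMatrix q y z)

/-- The row-generating polynomial `F̂_n(x;q,y,z) = ∑_{k=0}^n f̂_{n,k}(q,y,z) x^k`. -/
noncomputable def rowGenerating (q x y z : K) (n : ℕ) : K :=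
  ∑ k ∈ Finset.range (n + 1), forestMatrix q y z n k * x ^ k

/-! All the infinite products above are sums of finite support. -/

theorem rowFinite_diagonal (d : ℕ → K) : RowFinite (Matrix.diagonal d) := fun n =>
  (Set.finite_singleton n).subset fun k hk => by
    by_contra h
    exact hk (Matrix.diagonal_apply_ne _ (fun e => h e.symm))

theorem rowFinite_toeplitz (a : ℕ → K) : RowFinite (toeplitz a) := fun n =>
  (Set.finite_Iic n).subset fun k hk => by
    by_contra h
    exact hk (if_neg h)

theorem rowFinite_shiftMatrix : RowFinite (shiftMatrix : Matrix ℕ ℕ K) := fun n =>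
  (Set.finite_singleton (n + 1)).subset fun k hk => by
    by_contra h
    exact hk (if_neg fun e => h e.symm)

theorem RowFinite.infMul {A B : Matrix ℕ ℕ K} (hA : RowFinite A) (hB : RowFinite B) :
    RowFinite (infMul A B) := fun n =>
  ((hA n).biUnion fun j _ => hB j).subset fun k hk => by
    obtain ⟨j, hj⟩ : ∃ j, A n j * B j k ≠ 0 := by
      by_contra! h
      exact hk (by simp [QForest.infMul, h])
    exact Set.mem_biUnion (x := j) (left_ne_zero_of_mul hj) (right_ne_zero_of_mul hj)

theorem rowFinite_productionMatrix (q y z : K) : RowFinite (productionMatrix q y z) :=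
  ((((rowFinite_diagonal _).infMul (rowFinite_toeplitz _)).infMul
    (rowFinite_toeplitz _)).infMul (rowFinite_diagonal _)).infMul rowFinite_shiftMatrix

theorem RowFinite.infPow {A : Matrix ℕ ℕ K} (hA : RowFinite A) (n : ℕ) :
    RowFinite (infPow A n) := by
  induction n with
  | zero => exact rowFinite_diagonal _
  | succ n ih => exact ih.infMul hA

end InfiniteMatrices

/-! ### Coefficientwise total positivity -/

section TotalPositivity

variable {σ : Type*}

/-- `P ⪰ 0`: all coefficients of the polynomial are nonnegative. -/
def CoeffNonneg (P : MvPolynomial σ ℝ) : Prop :=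
  ∀ m, 0 ≤ P.coeff m

/-- All minors of the matrix are polynomials with nonnegative coefficients: the minors are indexed
by increasing choices of finitely many rows and as many columns. -/
def CoeffTotallyPositive (M : Matrix ℕ ℕ (MvPolynomial σ ℝ)) : Prop :=
  ∀ (r : ℕ) (rows cols : Fin r ↪o ℕ), CoeffNonneg (M.submatrix rows cols).det

/-- The Hankel matrix `H_∞(a) = (a_{n+k})_{n,k}`. -/
def hankel {R : Type*} (a : ℕ → R) : Matrix ℕ ℕ R :=
  Matrix.of fun n k => a (n + k)

/-- The Hankel matrix of the sequence is coefficientwise totally positive. -/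
def CoeffHankelTotallyPositive (a : ℕ → MvPolynomial σ ℝ) : Prop :=
  CoeffTotallyPositive (hankel a)

end TotalPositivity

/-! ### The indeterminates -/

/-- The four indeterminates. -/
inductive Var
  | q
  | x
  | y
  | z

/-- The polynomial ring `ℝ[q,x,y,z]`. -/
abbrev Poly : Type := MvPolynomial Var ℝ

/-- The field of rational functions `ℝ(q,x,y,z)`. -/
abbrev RatFunc4 : Type := FractionRing Poly

/-- An indeterminate, as a rational function. -/
noncomputable def ind (v : Var) : RatFunc4 :=
  algebraMap Poly RatFunc4 (MvPolynomial.X v)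

/-- The inverse of `D_q` is genuine: `[n]_q!` is a nonzero rational function. -/
theorem qFactorial_ind_ne_zero (n : ℕ) : qFactorial (ind Var.q) n ≠ 0 := by
  refine Finset.prod_ne_zero_iff.mpr fun j hj => ?_
  have hj1 : 1 ≤ j := (Finset.mem_Icc.mp hj).1
  have h : qNumber (ind Var.q) j =
      algebraMap Poly RatFunc4 (∑ i ∈ Finset.range j, MvPolynomial.X Var.q ^ i) := by
    simp [qNumber, ind]
  rw [h]
  intro h0
  have h1 : (∑ i ∈ Finset.range j, (MvPolynomial.X Var.q : Poly) ^ i) = 0 :=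
    (map_eq_zero_iff _ (IsFractionRing.injective Poly RatFunc4)).mp h0
  have h2 := congrArg (MvPolynomial.eval fun _ => (1 : ℝ)) h1
  simp at h2
  omega

end QForest

namespace QForest

open Finset Matrix

/-! ### Total positivity relative to a subsemiring -/

section Minors

variable {R : Type*} [CommRing R] {m n : Type*} [LinearOrder m] [LinearOrder n]

/-! Let `B(x)` be the q-binomial matrix `qBinom q x`, with zeroth column `(x^n)` and zeroth row
`(1,0,0,…)`. Then `F̂_n` is the `(0,0)` entry of `P'^n B(x)`. The q-Pascal rule says `Δ B(x) = B(x)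
(Δ + x diag(q^n))`, and `B(x)` commutes with every `D_q T D_q⁻¹`, `T` lower-triangular Toeplitz,
because such `T` commute. Hence `P' B(x) = B(x) W` with `W = B(z) Y (Δ + x diag(q^n))`, `Y = D_q
T_∞(y) D_q⁻¹`, and `F̂_n = (W^n)₀₀` (`rowGenerating_eq`). The three factors of `W` are totally
positive, so `W` is too by Cauchy–Binet. Finally `(W^(n+k))₀₀ = ∑_j (W^n)₀ⱼ (W^k)ⱼ₀` writes the
Hankel matrix as a product of two totally positive matrices (`minorsIn_hankel_pow`). Positivity
means that minors lie in a subsemiring of the field. Choosing the image of the polynomials with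
nonnegative coefficients yields polynomiality at the same time. -/

/-- The Cauchy–Binet formula. -/
theorem det_mul_eq_sum_strictMono {r N : ℕ} (A : Matrix (Fin r) (Fin N) R)
    (B : Matrix (Fin N) (Fin r) R) :
    (A * B).det = ∑ g : Fin r → Fin N with StrictMono g,
      (A.submatrix id g).det * (B.submatrix g id).det := by
  classical
  have expand : (A * B).det =
      ∑ p : Fin r → Fin N, (∏ i, A i (p i)) * (B.submatrix p id).det := by
    have h := (detRowAlternating : (Fin r → R) [⋀^Fin r]→ₗ[R] R).toMultilinearMap.map_sum
      (fun (i : Fin r) (j : Fin N) => A i j • B j)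
    have e : (A * B) = fun i => ∑ j, A i j • B j := by
      ext i k
      simp [Matrix.mul_apply, Finset.sum_apply]
    rw [e]
    refine h.trans (Finset.sum_congr rfl fun p _ => ?_)
    rw [MultilinearMap.map_smul_univ, smul_eq_mul]
    rfl
  have inj : (A * B).det = ∑ p : Fin r → Fin N with Function.Injective p,
      (∏ i, A i (p i)) * (B.submatrix p id).det := by
    rw [expand, Finset.sum_filter_of_ne]
    intro p _ hp i j hij
    by_contra hne
    exact hp (by rw [det_zero_of_row_eq hne (by funext k; simp [hij]), mul_zero])
  -- An injective `p` is uniquely `g ∘ σ` with `g` increasing and `σ` a permutation; sorting `p`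
  -- produces both.
  have pairs : (∑ p : Fin r → Fin N with Function.Injective p,
      (∏ i, A i (p i)) * (B.submatrix p id).det) =
      ∑ c ∈ (univ.filter fun g : Fin r → Fin N => StrictMono g) ×ˢ
        (univ : Finset (Equiv.Perm (Fin r))),
        (∏ i, A i (c.1 (c.2 i))) * (B.submatrix (c.1 ∘ c.2) id).det := by
    symm
    refine Finset.sum_bij (fun c _ => c.1 ∘ c.2) ?_ ?_ ?_ ?_
    · rintro ⟨g, σ⟩ h
      simp only [mem_product, mem_filter, mem_univ, true_and, and_true] at h ⊢
      exact h.injective.comp σ.injective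
    · rintro ⟨g, σ⟩ h ⟨g', σ'⟩ h' e
      simp only [mem_product, mem_filter, mem_univ, true_and, and_true] at h h' e
      have hg : g = g' := by
        refine (StrictMono.range_inj h h').mp ?_
        rw [← σ.surjective.range_comp g, e, σ'.surjective.range_comp]
      subst hg
      refine Prod.ext rfl (Equiv.ext fun i => h.injective (congrFun e i))
    · intro p hp
      simp only [mem_filter, mem_univ, true_and] at hp
      refine ⟨(p ∘ Tuple.sort p, (Tuple.sort p)⁻¹), ?_, ?_⟩
      · simp only [mem_product, mem_filter, mem_univ, true_and, and_true]
        exact (Tuple.monotone_sort p).strictMono_of_injective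
          (hp.comp (Tuple.sort p).injective)
      · funext i
        simp
    · rintro ⟨g, σ⟩ _
      rfl
  rw [inj, pairs, Finset.sum_product]
  refine Finset.sum_congr rfl fun g _ => ?_
  have hB : ∀ σ : Equiv.Perm (Fin r), (B.submatrix (g ∘ σ) id).det =
      (Equiv.Perm.sign σ : ℤ) * (B.submatrix g id).det := fun σ => by
    rw [← det_permute]
    rfl
  simp only [hB]
  rw [← det_transpose (A.submatrix id g), det_apply' (A.submatrix id g)ᵀ, Finset.sum_mul]
  refine Finset.sum_congr rfl fun σ _ => ?_
  simp only [transpose_apply, submatrix_apply, id]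
  ring

/-- All minors of the matrix belong to the subsemiring `S`. -/
def MinorsIn (S : Subsemiring R) (A : Matrix m n R) : Prop :=
  ∀ (r : ℕ) (f : Fin r → m) (g : Fin r → n), StrictMono f → StrictMono g →
    (A.submatrix f g).det ∈ S

theorem MinorsIn.transpose {S : Subsemiring R} {A : Matrix m n R} (hA : MinorsIn S A) :
    MinorsIn S Aᵀ := fun r f g hf hg => by
  rw [← transpose_submatrix, det_transpose]
  exact hA r g f hg hf

theorem MinorsIn.entry {S : Subsemiring R} {A : Matrix m n R} (hA : MinorsIn S A)
    (i : m) (j : n) : A i j ∈ S := by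
  have h := hA 1 (fun _ => i) (fun _ => j) (Subsingleton.strictMono _) (Subsingleton.strictMono _)
  simpa using h

/-- Product of matrices along an infinite index set, with sums of finite support. -/
theorem MinorsIn.of_finsum {S : Subsemiring R} {A : Matrix m ℕ R} {B : Matrix ℕ n R}
    {C : Matrix m n R} (hA : MinorsIn S A) (hB : MinorsIn S B)
    (hfin : ∀ i k, (Function.support fun j => A i j * B j k).Finite)
    (hC : ∀ i k, C i k = ∑ᶠ j, A i j * B j k) : MinorsIn S C := by
  intro r f g hf hg
  -- A minor involves finitely many entries, so one truncation of the inner index serves them all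
  -- and finite Cauchy–Binet applies.
  obtain ⟨N, hN⟩ : ∃ N : ℕ, ∀ a b j, A (f a) j * B j (g b) ≠ 0 → j < N := by
    have h : (⋃ a, ⋃ b, Function.support fun j => A (f a) j * B j (g b)).Finite :=
      Set.finite_iUnion fun a => Set.finite_iUnion fun b => hfin _ _
    obtain ⟨N, hN⟩ := h.bddAbove
    refine ⟨N + 1, fun a b j hj => Nat.lt_succ_of_le (hN ?_)⟩
    exact Set.mem_iUnion.mpr ⟨a, Set.mem_iUnion.mpr ⟨b, hj⟩⟩
  have e : C.submatrix f g =
      A.submatrix f (Fin.val : Fin N → ℕ) * B.submatrix (Fin.val : Fin N → ℕ) g := by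
    ext a b
    rw [submatrix_apply, hC, finsum_eq_sum_of_support_subset (s := range N) _
      (fun j hj => by simpa using hN a b j hj), Matrix.mul_apply, ← Fin.sum_univ_eq_sum_range
      (fun j => A (f a) j * B j (g b))]
    rfl
  rw [e, det_mul_eq_sum_strictMono]
  refine sum_mem fun p hp => ?_
  have hp : StrictMono p := (mem_filter.mp hp).2
  exact S.mul_mem (hA r f (fun i => (p i : ℕ)) hf hp) (hB r (fun i => (p i : ℕ)) g hp hg)

theorem det_eq_of_row_zero {r : ℕ} (A : Matrix (Fin (r + 1)) (Fin (r + 1)) R)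
    (h : ∀ j : Fin r, A 0 j.succ = 0) :
    A.det = A 0 0 * (A.submatrix Fin.succ Fin.succ).det := by
  rw [det_succ_row_zero, Fin.sum_univ_succ]
  simp [h, submatrix]

theorem det_eq_of_col_zero {r : ℕ} (A : Matrix (Fin (r + 1)) (Fin (r + 1)) R)
    (h : ∀ i : Fin r, A i.succ 0 = 0) :
    A.det = A 0 0 * (A.submatrix Fin.succ Fin.succ).det := by
  rw [← det_transpose, det_eq_of_row_zero _ h, ← det_transpose (A.submatrix _ _)]
  rfl

/-- Minors built by repeatedly splitting off the leading entry. -/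
theorem MinorsIn.of_leading {S : Subsemiring R} {A : Matrix m n R} (hS : ∀ i j, A i j ∈ S)
    (h : ∀ (r : ℕ) (f : Fin (r + 1) → m) (g : Fin (r + 1) → n), StrictMono f → StrictMono g →
      (A.submatrix f g).det = 0 ∨ (A.submatrix f g).det =
        A (f 0) (g 0) * (A.submatrix (f ∘ Fin.succ) (g ∘ Fin.succ)).det) :
    MinorsIn S A := by
  intro r
  induction r with
  | zero => intro f g _ _; simp
  | succ r ih =>
    intro f g hf hg
    rcases h r f g hf hg with h | h
    · rw [h]; exact S.zero_mem
    · rw [h]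
      exact S.mul_mem (hS _ _)
        (ih _ _ (hf.comp (Fin.strictMono_succ)) (hg.comp (Fin.strictMono_succ)))

/-- Upper bidiagonal matrices. -/
theorem MinorsIn.of_bidiagonal {S : Subsemiring R} {A : Matrix ℕ ℕ R} (hS : ∀ i j, A i j ∈ S)
    (h0 : ∀ i j, A i j ≠ 0 → j = i ∨ j = i + 1) : MinorsIn S A := by
  refine .of_leading hS fun r f g hf hg => Or.inr ?_
  -- If `g 0 ≤ f 0`, lower rows start right of column `g 0`; otherwise row `f 0` ends at column `g
  -- 0` at the latest.
  rcases le_or_gt (g 0) (f 0) with hle | hlt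
  · refine det_eq_of_col_zero _ fun i => ?_
    by_contra hne
    have h1 := h0 _ _ hne
    have h2 : f 0 < f i.succ := hf i.succ_pos
    omega
  · refine det_eq_of_row_zero _ fun j => ?_
    by_contra hne
    have h1 := h0 _ _ hne
    have h2 : g 0 < g j.succ := hg j.succ_pos
    omega

/-- Lower triangular matrices all of whose entries on and below the diagonal are quotients
`a n / a k`. -/
theorem MinorsIn.of_multiplicative {S : Subsemiring R} {A : Matrix ℕ ℕ R} (hS : ∀ i j, A i j ∈ S)
    (h0 : ∀ i j, i < j → A i j = 0)
    (hmul : ∀ i j k, k ≤ j → j ≤ i → A i k = A i j * A j k) : MinorsIn S A := by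
  refine .of_leading hS fun r f g hf hg => ?_
  rcases lt_or_ge (f 0) (g 0) with hlt | hge
  · left
    refine det_eq_zero_of_row_eq_zero 0 fun j => h0 _ _ (hlt.trans_le (hg.monotone (Fin.zero_le j)))
  by_cases hex : ∃ j : Fin r, g j.succ ≤ f 0
  -- All chosen rows lie at or below `g j.succ`, so multiplicativity makes column `g 0` equal to `A
  -- (g j.succ) (g 0)` times column `g j.succ`, and the minor vanishes.
  · left
    obtain ⟨j, hj⟩ := hex
    have hne : (0 : Fin (r + 1)) ≠ j.succ := (Fin.succ_ne_zero j).symm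
    rw [← det_updateCol_add_smul_self _ hne (-A (g j.succ) (g 0))]
    refine det_eq_zero_of_column_eq_zero 0 fun i => ?_
    have h1 : g 0 < g j.succ := hg j.succ_pos
    have h2 : f 0 ≤ f i := hf.monotone (Fin.zero_le i)
    simp [hmul (f i) (g j.succ) (g 0) h1.le (hj.trans h2), mul_comm]
  · right
    push Not at hex
    exact det_eq_of_row_zero _ fun j => h0 _ _ (hex j)

/-- Placing the row `(1, 0, 0, …)` on top. -/
theorem MinorsIn.cons_single {S : Subsemiring R} {N : ℕ} {A : Matrix (Fin N) ℕ R}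
    {A' : Matrix (Fin (N + 1)) ℕ R} (hA : MinorsIn S A)
    (h0 : A' 0 = Pi.single 0 1) (hs : ∀ i : Fin N, A' i.succ = A i) : MinorsIn S A' := by
  have key : ∀ (r : ℕ) (f : Fin r → Fin (N + 1)) (g : Fin r → ℕ), StrictMono f → StrictMono g →
      (∀ i, f i ≠ 0) → (A'.submatrix f g).det ∈ S := by
    intro r f g hf hg hne
    have e : A'.submatrix f g = A.submatrix (fun i => (f i).pred (hne i)) g := by
      ext i j
      rw [submatrix_apply, submatrix_apply, ← hs, Fin.succ_pred]
    rw [e]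
    exact hA _ _ _ (fun i j hij => Fin.pred_lt_pred_iff.mpr (hf hij)) hg
  intro r f g hf hg
  cases r with
  | zero => simp
  | succ r =>
    by_cases hf0 : f 0 = 0
    · rw [det_eq_of_row_zero]
      · refine S.mul_mem ?_ ?_
        · rw [submatrix_apply, hf0, h0, Pi.single_apply]
          split_ifs
          exacts [S.one_mem, S.zero_mem]
        · refine key r (f ∘ Fin.succ) (g ∘ Fin.succ) (hf.comp Fin.strictMono_succ)
            (hg.comp Fin.strictMono_succ) fun i => ?_
          exact (lt_of_le_of_lt (Fin.zero_le _) (hf i.succ_pos)).ne'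
      · intro j
        have : g j.succ ≠ 0 := (lt_of_le_of_lt (Nat.zero_le _) (hg j.succ_pos)).ne'
        rw [submatrix_apply, hf0, h0, Pi.single_eq_of_ne this]
    · exact key _ f g hf hg fun i =>
        (lt_of_lt_of_le (Fin.pos_of_ne_zero hf0) (hf.monotone (Fin.zero_le i))).ne'

/-- Matrices whose rows are generated from `(1, 0, 0, …)` by repeated application of `P`. -/
theorem MinorsIn.of_recurrence {S : Subsemiring R} {A P : Matrix ℕ ℕ R} (hP : MinorsIn S P)
    (h0 : A 0 = Pi.single 0 1) (hs : ∀ n k, A (n + 1) k = ∑ᶠ j, A n j * P j k)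
    (hfin : ∀ n k, (Function.support fun j => A n j * P j k).Finite) : MinorsIn S A := by
  -- The first `N + 1` rows are `(1, 0, 0, …)` on top of the product of the first `N` rows with `P`.
  have trunc : ∀ N, MinorsIn S (A.submatrix (Fin.val : Fin N → ℕ) id) := by
    intro N
    induction N with
    | zero =>
      intro r f g hf hg
      cases r with
      | zero => simp
      | succ r => exact (f 0).elim0
    | succ N ih =>
      refine MinorsIn.cons_single
        (A := Matrix.of fun (i : Fin N) k => A (i + 1) k) ?_ h0 fun i => ?_
      · exact ih.of_finsum hP (fun i k => hfin i k) fun i k => hs i k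
      · ext k; simp
  intro r f g hf hg
  obtain ⟨N, hN⟩ : ∃ N, ∀ i, f i < N := by
    obtain ⟨N, hN⟩ := (Set.finite_range f).bddAbove
    exact ⟨N + 1, fun i => Nat.lt_succ_of_le (hN ⟨i, rfl⟩)⟩
  exact trunc N r (fun i => ⟨f i, hN i⟩) g (fun i j h => hf h) hg

end Minors

/-! ### The monoid of row-finite matrices -/

section RowFiniteMonoid

variable {K : Type*} [Field K]

theorem RowFinite.support_mul {A B : Matrix ℕ ℕ K} (hA : RowFinite A) (n k : ℕ) :
    (Function.support fun j => A n j * B j k).Finite :=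
  (hA n).subset fun _ hj => left_ne_zero_of_mul hj

theorem infMul_eq_sum {A : Matrix ℕ ℕ K} (B : Matrix ℕ ℕ K) {n : ℕ} {s : Finset ℕ}
    (hs : ∀ j, A n j ≠ 0 → j ∈ s) (k : ℕ) : infMul A B n k = ∑ j ∈ s, A n j * B j k :=
  finsum_eq_sum_of_support_subset _ fun j hj => hs j (left_ne_zero_of_mul hj)

theorem infMul_assoc {A B : Matrix ℕ ℕ K} (hA : RowFinite A) (hB : RowFinite B)
    (C : Matrix ℕ ℕ K) : infMul (infMul A B) C = infMul A (infMul B C) := by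
  ext n k
  set s := (hA n).toFinset
  have hs : ∀ j, A n j ≠ 0 → j ∈ s := fun j hj => by simpa [s] using hj
  set t := s.biUnion fun i => (hB i).toFinset
  have ht : ∀ i ∈ s, ∀ j, B i j ≠ 0 → j ∈ t := fun i hi j hj =>
    mem_biUnion.mpr ⟨i, hi, by simpa using hj⟩
  have hst : ∀ j, infMul A B n j ≠ 0 → j ∈ t := by
    intro j hj
    rw [infMul_eq_sum B hs] at hj
    obtain ⟨i, hi, hij⟩ := Finset.exists_ne_zero_of_sum_ne_zero hj
    exact ht i hi j (right_ne_zero_of_mul hij)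
  rw [infMul_eq_sum C hst, infMul_eq_sum _ hs]
  simp only [infMul_eq_sum B hs, Finset.sum_mul]
  rw [Finset.sum_comm]
  refine Finset.sum_congr rfl fun i hi => ?_
  rw [infMul_eq_sum C (ht i hi), Finset.mul_sum]
  exact Finset.sum_congr rfl fun j _ => mul_assoc _ _ _

theorem infMul_diagonal_left (d : ℕ → K) (A : Matrix ℕ ℕ K) (n k : ℕ) :
    infMul (Matrix.diagonal d) A n k = d n * A n k := by
  rw [infMul_eq_sum A (s := {n})]
  · simp
  · intro j hj
    by_contra h
    exact hj (Matrix.diagonal_apply_ne _ fun e => h (by simp [e]))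

theorem infMul_diagonal_right (A : Matrix ℕ ℕ K) (d : ℕ → K) (n k : ℕ) :
    infMul A (Matrix.diagonal d) n k = A n k * d k := by
  change (∑ᶠ j, A n j * Matrix.diagonal d j k) = _
  rw [finsum_eq_single _ k fun j hj => by rw [Matrix.diagonal_apply_ne _ hj, mul_zero],
    Matrix.diagonal_apply_eq]

variable (K) in
/-- Row-finite matrices. -/
def RowFiniteMatrix : Type _ := {A : Matrix ℕ ℕ K // RowFinite A}

noncomputable instance : Monoid (RowFiniteMatrix K) where
  mul A B := ⟨infMul A.1 B.1, A.2.infMul B.2⟩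
  one := ⟨1, rowFinite_diagonal _⟩
  mul_assoc A B C := Subtype.ext (infMul_assoc A.2 B.2 C.1)
  one_mul A := Subtype.ext (by
    ext n k
    exact (infMul_diagonal_left _ A.1 n k).trans (one_mul _))
  mul_one A := Subtype.ext (by
    ext n k
    exact (infMul_diagonal_right A.1 _ n k).trans (mul_one _))

namespace RowFiniteMatrix

theorem ext {A B : RowFiniteMatrix K} (h : ∀ n k, A.1 n k = B.1 n k) : A = B :=
  Subtype.ext (Matrix.ext h)

theorem val_one : (1 : RowFiniteMatrix K).1 = 1 := rfl

theorem val_mul (A B : RowFiniteMatrix K) : (A * B).1 = QForest.infMul A.1 B.1 := rfl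

theorem mul_apply (A B : RowFiniteMatrix K) (n k : ℕ) :
    (A * B).1 n k = ∑ᶠ j, A.1 n j * B.1 j k := rfl

theorem val_pow (A : RowFiniteMatrix K) (n : ℕ) : (A ^ n).1 = QForest.infPow A.1 n := by
  induction n with
  | zero => rfl
  | succ n ih => rw [pow_succ, val_mul, ih]; rfl

/-- The diagonal matrix as a row-finite matrix. -/
def diag (d : ℕ → K) : RowFiniteMatrix K := ⟨Matrix.diagonal d, rowFinite_diagonal d⟩

/-- The Toeplitz matrix as a row-finite matrix. -/
def toep (a : ℕ → K) : RowFiniteMatrix K := ⟨toeplitz a, rowFinite_toeplitz a⟩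

variable (K) in
/-- The matrix `Δ` as a row-finite matrix. -/
def shift : RowFiniteMatrix K := ⟨shiftMatrix, rowFinite_shiftMatrix⟩

theorem diag_mul_diag_inv {d : ℕ → K} (hd : ∀ n, d n ≠ 0) :
    diag d * diag (fun n => (d n)⁻¹) = 1 := by
  refine ext fun n k => ?_
  refine (infMul_diagonal_left _ _ n k).trans ?_
  change _ * Matrix.diagonal _ n k = (1 : Matrix ℕ ℕ K) n k
  rw [Matrix.diagonal_apply, Matrix.one_apply]
  split_ifs
  · exact mul_inv_cancel₀ (hd n)
  · exact mul_zero _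

theorem diag_inv_mul_diag {d : ℕ → K} (hd : ∀ n, d n ≠ 0) :
    diag (fun n => (d n)⁻¹) * diag d = 1 := by
  simpa using diag_mul_diag_inv (d := fun n => (d n)⁻¹) fun n => inv_ne_zero (hd n)

/-- The entries of the product are convolutions, symmetric under the reflection `j ↦ n + k - j`. -/
theorem commute_toep (a b : ℕ → K) : Commute (toep a) (toep b) := by
  have key : ∀ (a b : ℕ → K) (n k : ℕ),
      (toep a * toep b).1 n k = ∑ j ∈ Icc k n, a (n - j) * b (j - k) := by
    intro a b n k
    rw [mul_apply, finsum_eq_sum_of_support_subset (s := Icc k n)]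
    · refine Finset.sum_congr rfl fun j hj => ?_
      obtain ⟨h1, h2⟩ := mem_Icc.mp hj
      simp [toep, toeplitz, h1, h2]
    · intro j hj
      by_contra h
      apply hj
      rw [coe_Icc, Set.mem_Icc, not_and_or] at h
      rcases h with h | h <;> simp [toep, toeplitz, h]
  refine ext fun n k => ?_
  rw [key, key]
  refine Finset.sum_nbij' (fun j => n + k - j) (fun j => n + k - j) ?_ ?_ ?_ ?_ ?_ <;>
    intro j hj <;> obtain ⟨h1, h2⟩ := mem_Icc.mp hj
  · exact mem_Icc.mpr (by omega)
  · exact mem_Icc.mpr (by omega)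
  · omega
  · omega
  · rw [mul_comm, show n - (n + k - j) = j - k by omega, show n + k - j - k = n - j by omega]

theorem minorsIn_mul {S : Subsemiring K} {A B : RowFiniteMatrix K} (hA : MinorsIn S A.1)
    (hB : MinorsIn S B.1) : MinorsIn S (A * B).1 :=
  hA.of_finsum hB (fun n k => A.2.support_mul n k) (fun n k => mul_apply A B n k)

/-- The sequence `(Pⁿ)₀₀` is Hankel-totally positive when `P` is totally positive. -/
theorem minorsIn_hankel_pow {S : Subsemiring K} {P : RowFiniteMatrix K} (hP : MinorsIn S P.1) :
    MinorsIn S (hankel fun n => (P ^ n).1 0 0) := by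
  have h1 : MinorsIn S (Matrix.of fun n j => (P ^ n).1 0 j) := by
    refine MinorsIn.of_recurrence hP ?_ (fun n k => ?_) fun n k => (P ^ n).2.support_mul 0 k
    · ext j
      simp [val_one, Matrix.one_apply, Pi.single_apply, eq_comm]
    · simp only [Matrix.of_apply]
      rw [pow_succ, mul_apply]
  -- The zeroth columns of the powers follow the recurrence of `Pᵀ`, which need not be row-finite;
  -- finiteness of the sums comes from the rows of `P`.
  have h2 : MinorsIn S (Matrix.of fun n j => (P ^ n).1 j 0) := by
    refine MinorsIn.of_recurrence hP.transpose ?_ (fun n k => ?_) fun n k => ?_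
    · ext j
      simp [val_one, Matrix.one_apply, Pi.single_apply]
    · simp only [Matrix.of_apply, Matrix.transpose_apply]
      rw [pow_succ', mul_apply]
      exact finsum_congr fun j => mul_comm _ _
    · exact (P.2 k).subset fun j hj => right_ne_zero_of_mul hj
  refine h1.of_finsum h2.transpose (fun n k => (P ^ n).2.support_mul 0 0) fun n k => ?_
  simp only [hankel, Matrix.of_apply, Matrix.transpose_apply]
  rw [pow_add, mul_apply]

/-- The matrix has no nonzero entries above the `d`-th superdiagonal. -/
def VanishesAbove (d : ℕ) (A : RowFiniteMatrix K) : Prop := ∀ n k, n + d < k → A.1 n k = 0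

theorem VanishesAbove.mul {d e : ℕ} {A B : RowFiniteMatrix K} (hA : VanishesAbove d A)
    (hB : VanishesAbove e B) : VanishesAbove (d + e) (A * B) := fun n k hk => by
  rw [mul_apply]
  refine finsum_eq_zero_of_forall_eq_zero fun j => ?_
  rcases lt_or_ge (n + d) j with h | h
  · rw [hA n j h, zero_mul]
  · rw [hB j k (by omega), mul_zero]

theorem VanishesAbove.pow {d : ℕ} {A : RowFiniteMatrix K} (hA : VanishesAbove d A) (n : ℕ) :
    VanishesAbove (n * d) (A ^ n) := by
  induction n with
  | zero =>
    intro n k hk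
    exact Matrix.one_apply_ne (by omega)
  | succ n ih =>
    rw [pow_succ, Nat.succ_mul]
    exact ih.mul hA

theorem vanishesAbove_diag (d : ℕ → K) : VanishesAbove 0 (diag d) := fun _ _ h =>
  Matrix.diagonal_apply_ne _ (by omega)

theorem vanishesAbove_toep (a : ℕ → K) : VanishesAbove 0 (toep a) := fun _ _ h =>
  if_neg (by omega)

theorem vanishesAbove_shift : VanishesAbove 1 (shift K) := fun _ _ h =>
  if_neg (by omega)

end RowFiniteMatrix

end RowFiniteMonoid

/-! ### The production matrix -/

section Production

variable {K : Type*} [Field K]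

theorem qFactorial_succ (q : K) (n : ℕ) :
    qFactorial q (n + 1) = qFactorial q n * qNumber q (n + 1) :=
  Finset.prod_Icc_succ_top (by omega) _

theorem qFactorial_zero (q : K) : qFactorial q 0 = 1 := by simp [qFactorial]

theorem qNumber_add (q : K) (k a : ℕ) :
    qNumber q (k + a) = qNumber q k + q ^ k * qNumber q a := by
  simp [qNumber, Finset.sum_range_add, pow_add, Finset.mul_sum]

/-- The bidiagonal matrix `Δ + x diag(q^n)`. -/
def bidiagonal (q x : K) : Matrix ℕ ℕ K :=
  Matrix.of fun n k => if k = n + 1 then 1 else if k = n then x * q ^ n else 0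

theorem rowFinite_bidiagonal (q x : K) : RowFinite (bidiagonal q x) := fun n =>
  (Set.finite_Iic (n + 1)).subset fun k hk => by
    by_contra h
    rw [Set.mem_Iic] at h
    exact hk ((if_neg (by omega)).trans (if_neg (by omega)))

namespace RowFiniteMatrix

/-- The matrix `Δ + x diag(q^n)` as a row-finite matrix. -/
def bidiag (q x : K) : RowFiniteMatrix K := ⟨bidiagonal q x, rowFinite_bidiagonal q x⟩

/-- `D_q T_∞(a) D_q⁻¹`. -/
noncomputable def qToep (q : K) (a : ℕ → K) : RowFiniteMatrix K :=
  diag (qFactorial q) * toep a * diag fun n => (qFactorial q n)⁻¹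

/-- The `q`-binomial matrix. -/
noncomputable def qBinom (q x : K) : RowFiniteMatrix K :=
  qToep q fun n => x ^ n / qFactorial q n

theorem qToep_apply (q : K) (a : ℕ → K) (n k : ℕ) :
    (qToep q a).1 n k =
      if k ≤ n then qFactorial q n * a (n - k) * (qFactorial q k)⁻¹ else 0 := by
  refine (infMul_diagonal_right _ _ n k).trans ?_
  change infMul (Matrix.diagonal _) (toeplitz a) n k * _ = _
  rw [infMul_diagonal_left, toeplitz, Matrix.of_apply]
  split_ifs <;> simp

theorem vanishesAbove_qToep (q : K) (a : ℕ → K) : VanishesAbove 0 (qToep q a) :=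
  ((vanishesAbove_diag _).mul (vanishesAbove_toep _)).mul (vanishesAbove_diag _)

theorem qBinom_apply_zero_left (q x : K) : (qBinom q x).1 0 = Pi.single 0 1 := by
  ext k
  rw [qBinom, qToep_apply, Pi.single_apply]
  by_cases h : k = 0 <;> simp [h, qFactorial_zero]

theorem minorsIn_bidiag {S : Subsemiring K} {q x : K} (hqS : q ∈ S) (hx : x ∈ S) : MinorsIn S (bidiag q x).1 := by
  refine .of_bidiagonal (fun i j => ?_) fun i j h => ?_
  · simp only [bidiag, bidiagonal, Matrix.of_apply]
    split_ifs
    exacts [S.one_mem, S.mul_mem hx (S.pow_mem hqS _), S.zero_mem]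
  · by_contra hne
    rw [not_or] at hne
    exact h ((if_neg hne.2).trans (if_neg hne.1))

variable {q : K} (hq : ∀ n, qFactorial q n ≠ 0)

include hq

theorem qToep_mul (a b : ℕ → K) : qToep q a * qToep q b =
    diag (qFactorial q) * toep a * toep b * diag fun n => (qFactorial q n)⁻¹ := by
  simp only [qToep, mul_assoc]
  rw [← mul_assoc (diag fun n => (qFactorial q n)⁻¹) (diag (qFactorial q)),
    diag_inv_mul_diag hq, one_mul]

theorem commute_qToep (a b : ℕ → K) : Commute (qToep q a) (qToep q b) := by
  rw [commute_iff_eq, qToep_mul hq, qToep_mul hq, mul_assoc _ (toep a), mul_assoc _ (toep b),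
    (commute_toep a b).eq]

theorem qBinom_apply_zero_right (x : K) (n : ℕ) : (qBinom q x).1 n 0 = x ^ n := by
  rw [qBinom, qToep_apply]
  have := hq n
  simp [qFactorial_zero]
  field_simp

theorem qBinom_succ_zero (x : K) (n : ℕ) :
    (qBinom q x).1 (n + 1) 0 = x * (qBinom q x).1 n 0 := by
  rw [qBinom_apply_zero_right hq, qBinom_apply_zero_right hq, pow_succ']

/-- The q-Pascal rule, from `[n+1] = [k+1] + q^(k+1) [n-k]`. -/
theorem qBinom_succ_succ (x : K) (n k : ℕ) : (qBinom q x).1 (n + 1) (k + 1) =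
    (qBinom q x).1 n k + x * q ^ (k + 1) * (qBinom q x).1 n (k + 1) := by
  simp only [qBinom, qToep_apply]
  rcases lt_trichotomy n k with h | rfl | h
  · simp [show ¬ k + 1 ≤ n + 1 by omega, show ¬ k ≤ n by omega, show ¬ k + 1 ≤ n by omega]
  · simp [qFactorial_zero, mul_inv_cancel₀ (hq _)]
  · obtain ⟨a, rfl⟩ := Nat.exists_eq_add_of_lt h
    rw [if_pos (by omega), if_pos (by omega), if_pos (by omega),
      show k + a + 1 + 1 - (k + 1) = a + 1 by omega, show k + a + 1 - k = a + 1 by omega,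
      show k + a + 1 - (k + 1) = a by omega, qFactorial_succ q (k + a + 1),
      show k + a + 1 + 1 = (k + 1) + (a + 1) by omega, qNumber_add]
    have h1 := hq a
    have h2 := hq k
    have h3 := hq (a + 1)
    have h4 := hq (k + 1)
    rw [qFactorial_succ] at h3 h4
    have h5 := right_ne_zero_of_mul h3
    have h6 := right_ne_zero_of_mul h4
    rw [qFactorial_succ q k, qFactorial_succ q a]
    field_simp
    ring

/-- Used twice: it generates the q-binomial matrix from a totally positive bidiagonal one, and it
gives the intertwining with `Δ`. -/
theorem qBinom_succ (x : K) (n k : ℕ) :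
    (qBinom q x).1 (n + 1) k = ∑ᶠ j, (qBinom q x).1 n j * (bidiag q x).1 j k := by
  cases k with
  | zero =>
    rw [finsum_eq_single _ 0 fun j hj => by simp [bidiag, bidiagonal, hj.symm],
      qBinom_succ_zero hq]
    simp [bidiag, bidiagonal, mul_comm]
  | succ k =>
    rw [finsum_eq_sum_of_support_subset (s := {k, k + 1}), Finset.sum_pair (by omega),
      qBinom_succ_succ hq]
    · simp [bidiag, bidiagonal, mul_comm]
    · intro j hj
      by_contra h
      apply hj
      simp only [coe_insert, coe_singleton, Set.mem_insert_iff, Set.mem_singleton_iff,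
        not_or] at h
      simp [bidiag, bidiagonal, show ¬ k = j by omega, show ¬ k + 1 = j by omega]

theorem shift_mul_qBinom (x : K) : shift K * qBinom q x = qBinom q x * bidiag q x := by
  refine ext fun n k => ?_
  rw [mul_apply, mul_apply, ← qBinom_succ hq,
    finsum_eq_single _ (n + 1) fun j hj => by simp [shift, shiftMatrix, hj.symm]]
  simp [shift, shiftMatrix]

theorem minorsIn_qBinom {S : Subsemiring K} {x : K} (hqS : q ∈ S) (hx : x ∈ S) : MinorsIn S (qBinom q x).1 :=
  .of_recurrence (minorsIn_bidiag hqS hx) (qBinom_apply_zero_left q x) (qBinom_succ hq x)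
    fun n k => (qBinom q x).2.support_mul n k

/-- On and below the diagonal the entries are `([n]! / [k]!) y^(n-k)`, which multiply along chains
of indices; `[n]! / [k]!` is a product of q-numbers, hence lies in `S`. -/
theorem minorsIn_qToep_pow {S : Subsemiring K} {y : K} (hqS : q ∈ S) (hy : y ∈ S) :
    MinorsIn S (qToep q fun n => y ^ n).1 := by
  have hdiv : ∀ k a, qFactorial q (k + a) * (qFactorial q k)⁻¹ ∈ S := by
    intro k a
    induction a with
    | zero => rw [add_zero, mul_inv_cancel₀ (hq k)]; exact S.one_mem
    | succ a ih =>
      rw [← add_assoc, qFactorial_succ, mul_right_comm]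
      exact S.mul_mem ih (sum_mem fun i _ => S.pow_mem hqS i)
  refine .of_multiplicative (fun i j => ?_) (fun i j h => ?_) fun i j k hkj hji => ?_
  · rw [qToep_apply]
    split_ifs with h
    · obtain ⟨a, rfl⟩ := Nat.exists_eq_add_of_le h
      rw [mul_right_comm]
      exact S.mul_mem (hdiv j a) (S.pow_mem hy _)
    · exact S.zero_mem
  · rw [qToep_apply, if_neg (by omega)]
  · rw [qToep_apply, qToep_apply, qToep_apply, if_pos hkj, if_pos hji, if_pos (hkj.trans hji),
      show i - k = (i - j) + (j - k) by omega, pow_add]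
    have := hq j
    field_simp

theorem productionMatrix_eq (y z : K) : productionMatrix q y z =
    (qBinom q z * (qToep q fun n => y ^ n) * shift K).1 := by
  rw [qBinom, qToep_mul hq]
  rfl

/-- Conjugation by the `q`-binomial matrix moves the row-generating polynomials of the output
matrix into its zeroth column. -/
theorem rowGenerating_eq (x y z : K) (n : ℕ) : rowGenerating q x y z n =
    ((qBinom q z * (qToep q fun n => y ^ n) * bidiag q x) ^ n).1 0 0 := by
  set Y := qToep q fun n => y ^ n
  set P := qBinom q z * Y * shift K with hP
  set W := qBinom q z * Y * bidiag q x with hW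
  -- This reads `B(x) W = P B(x)`; no inverse of `B(x)` is needed.
  have hsemi : SemiconjBy (qBinom q x) W P := by
    have h1 : Commute (qBinom q x) (qBinom q z * Y) :=
      (commute_qToep hq _ _).mul_right (commute_qToep hq _ _)
    rw [SemiconjBy, hP, hW, mul_assoc _ (shift K), shift_mul_qBinom hq, ← mul_assoc, h1.eq,
      mul_assoc]
  -- Row `0` of `P ^ n` stops at column `n`, so the product sum is exactly the one defining
  -- `rowGenerating`.
  have hvan : VanishesAbove n (P ^ n) := by
    have h1 : VanishesAbove 1 P :=
      ((vanishesAbove_qToep q _).mul (vanishesAbove_qToep q _)).mul vanishesAbove_shift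
    simpa using h1.pow n
  have h : (P ^ n * qBinom q x).1 0 0 = (W ^ n).1 0 0 := by
    rw [← (hsemi.pow_right n).eq, mul_apply, qBinom_apply_zero_left q,
      finsum_eq_single _ 0 fun j hj => by rw [Pi.single_eq_of_ne hj, zero_mul]]
    simp
  rw [← h, mul_apply, finsum_eq_sum_of_support_subset (s := range (n + 1)), rowGenerating]
  · refine Finset.sum_congr rfl fun k _ => ?_
    rw [qBinom_apply_zero_right hq, forestMatrix, productionMatrix_eq hq, outputMatrix,
      Matrix.of_apply, ← val_pow]
  · intro j hj
    by_contra hlt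
    exact left_ne_zero_of_mul hj (hvan 0 j (by simpa using hlt))

theorem minorsIn_hankel_rowGenerating {S : Subsemiring K} {x y z : K} (hqS : q ∈ S) (hx : x ∈ S) (hy : y ∈ S)
    (hz : z ∈ S) : MinorsIn S (hankel (rowGenerating q x y z)) := by
  rw [show rowGenerating q x y z = _ from funext (rowGenerating_eq hq x y z)]
  exact minorsIn_hankel_pow (minorsIn_mul (minorsIn_mul (minorsIn_qBinom hq hqS hz)
    (minorsIn_qToep_pow hq hqS hy)) (minorsIn_bidiag hqS hx))

end RowFiniteMatrix

end Production

/-! ### Descent from the fraction field to polynomials -/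

/-- The polynomials with nonnegative coefficients. -/
def coeffNonnegSubsemiring (σ : Type*) : Subsemiring (MvPolynomial σ ℝ) where
  carrier := {P | CoeffNonneg P}
  mul_mem' {P Q} hP hQ m := by
    classical
    rw [MvPolynomial.coeff_mul]
    exact Finset.sum_nonneg fun a _ => mul_nonneg (hP _) (hQ _)
  one_mem' m := by
    classical
    rw [MvPolynomial.coeff_one]
    split_ifs <;> norm_num
  add_mem' {P Q} hP hQ m := by
    rw [MvPolynomial.coeff_add]
    exact add_nonneg (hP m) (hQ m)
  zero_mem' m := (MvPolynomial.coeff_zero m).ge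

theorem X_mem_coeffNonnegSubsemiring {σ : Type*} (i : σ) :
    MvPolynomial.X i ∈ coeffNonnegSubsemiring σ := fun m => by
  classical
  rw [MvPolynomial.coeff_X]
  split_ifs <;> norm_num

end QForest

/-- With `q, x, y, z` indeterminates, the row-generating polynomials of `F̂(q,y,z) = O(P'(q,y,z))`,
computed in `ℝ(q,x,y,z)`, are polynomials in `ℝ[q,x,y,z]`, and their sequence is coefficientwise
Hankel-totally positive jointly in `q, x, y, z`. -/
theorem lemma6p2 :
    ∃ F : ℕ → QForest.Poly,
      (∀ n : ℕ, algebraMap QForest.Poly QForest.RatFunc4 (F n) =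
        QForest.rowGenerating (QForest.ind QForest.Var.q) (QForest.ind QForest.Var.x)
          (QForest.ind QForest.Var.y) (QForest.ind QForest.Var.z) n) ∧
      QForest.CoeffHankelTotallyPositive F := by
  have hind : ∀ v, QForest.ind v ∈ (QForest.coeffNonnegSubsemiring QForest.Var).map
      (algebraMap QForest.Poly QForest.RatFunc4) := fun v =>
    ⟨_, QForest.X_mem_coeffNonnegSubsemiring v, rfl⟩
  have hminors := QForest.RowFiniteMatrix.minorsIn_hankel_rowGenerating
    QForest.qFactorial_ind_ne_zero (hind .q) (hind .x) (hind .y) (hind .z)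
  -- The `1 × 1` minors already show that every term of the sequence is a polynomial.
  have hentry := fun n => hminors.entry n 0
  choose F _ hF using hentry
  refine ⟨F, hF, fun r rows cols => ?_⟩
  obtain ⟨P, hP, hdet⟩ := hminors r rows cols rows.strictMono cols.strictMono
  -- A minor computed in the field has a nonnegative preimage `P`; injectivity of `algebraMap`
  -- identifies it with the minor of `F`.
  have e : P = ((QForest.hankel F).submatrix rows cols).det := by
    apply IsFractionRing.injective QForest.Poly QForest.RatFunc4
    refine hdet.trans ?_
    rw [RingHom.map_det]
    congr 1
    ext i j
    exact (hF _).symm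
  exact e ▸ hP
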